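/- Let $A=\{a,b\}$. For $P\in\mathbb{Z}\langle A\rangle$ (noncommutative polynomials) and $g\ge 0$, let $P_g$ be the part of $P$ formed by its terms on words with exactly $g$ occurrences of $b$; for a finite set $H\subset\mathbb{N}$ put $a^H=\sum_{h\in H}a^h$. A code is a set $C\subseteq A^*$ such that every word has at most one factorization into elements of $C$; it is maximal if it is not properly contained in another code over $A$. An $m$-code is a finite maximal code over $A$ each of whose words has at most $m$ occurrences of $b$, at least one word having exactly $m$. A factorization for a finite maximal code $C$ is a pair $(P,S)$ of polynomials in $\mathbb{Z}\langle A\rangle$ such that $\sum_{w\in C}w=P(a+b-1)S+1$; it is positive if $P,S$ both have all coefficients in $\{0,1\}$, or $-P,-S$ both do. Let $n\ge 1$ and let $(I,J)$ be a Krasner factorization of $\mathbb{Z}_n$, that is, a pair of finite subsets of $\mathbb{N}$ with $a^Ia^J=1+a+\cdots+a^{n-1}$. Let $M_j$ ($j\in J$) be finite subsets of $\mathbb{N}$, let $$S=a^J+\sum_{j\in J}a^{M_j}ba^j,$$ and let $P=P_0+\cdots+P_{k+1}\in\mathbb{N}\langle A\rangle$ with $k\ge 0$. If $(P,S)$ is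 a positive factorization for a $(k+3)$-code $C$, then for every $r\in\{0,\ldots,k\}$ such that $P_r\neq 0$, the pair $(P_0+\cdots+P_r,\,S)$ is a positive factorization for an $(r+2)$-code. -/

import Mathlib

namespace KrasnerCodes

/-- The two-letter alphabet `A = {a, b}`. -/
inductive Letter
  | a
  | b
  deriving DecidableEq

/-- The ring `ℤ⟨A⟩` of polynomials in the noncommuting variables `a, b` with integer
coefficients: finitely supported functions on words, with the concatenation product. -/
abbrev Poly : Type := MonoidAlgebra ℤ (FreeMonoid Letter)

noncomputable section

/-- A word of `A*`, viewed as a polynomial. -/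
def word (w : List Letter) : Poly := MonoidAlgebra.of ℤ (FreeMonoid Letter) (FreeMonoid.ofList w)

/-- The coefficient `(P, w)` of the word `w` in `P`. -/
def coef (P : Poly) (w : List Letter) : ℤ := P.coeff (FreeMonoid.ofList w)

/-- The letter `a` as a polynomial. -/
def polyA : Poly := word [Letter.a]

/-- The letter `b` as a polynomial. -/
def polyB : Poly := word [Letter.b]

/-- `a^H = ∑_{h ∈ H} a^h`, for a finite set `H` of nonnegative integers. -/
def aPow (H : Finset ℕ) : Poly := ∑ h ∈ H, polyA ^ h

/-- The characteristic polynomial of a finite set of words. -/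
def charPoly (C : Finset (List Letter)) : Poly := ∑ w ∈ C, word w

/-- The component `P_g`: the part of `P` supported on the words with exactly `g`
occurrences of `b`. -/
def bPart (g : ℕ) (P : Poly) : Poly :=
  MonoidAlgebra.ofCoeff (P.coeff.filter fun w => w.toList.count Letter.b = g)

/-- `P` has coefficients `0, 1`. -/
def HasCoeffsZeroOne (P : Poly) : Prop := ∀ w, coef P w = 0 ∨ coef P w = 1

/-- `(I, J)` is a Krasner factorization of the cyclic group of order `n ≥ 1`:
`a^I a^J = 1 + a + ⋯ + a^(n-1)`. -/
def IsKrasner (n : ℕ) (I J : Finset ℕ) : Prop :=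
  0 < n ∧ aPow I * aPow J = aPow (Finset.range n)

/-- `C` is a (finite) maximal code over `A`: it is maximal for inclusion among all codes,
that is, all uniquely decodable sets of words, finite or not. -/
def IsMaximalCode (C : Finset (List Letter)) : Prop :=
  Maximal InformationTheory.UniquelyDecodable (C : Set (List Letter))

/-- `C` is an `m`-code: a finite maximal code such that every word of `C` has at most `m`
occurrences of `b`, and some word of `C` has exactly `m`. -/
def IsMCode (m : ℕ) (C : Finset (List Letter)) : Prop :=
  IsMaximalCode C ∧ (∀ w ∈ C, w.count Letter.b ≤ m) ∧ ∃ w ∈ C, w.count Letter.b = m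

/-- `(P, S)` is a factorization for the finite maximal code `C`: `C = P (A - 1) S + 1`. -/
def IsFactorization (P S : Poly) (C : Finset (List Letter)) : Prop :=
  IsMaximalCode C ∧ charPoly C = P * (polyA + polyB - 1) * S + 1

/-- The factorization `(P, S)` for `C` is positive: `P, S` or `-P, -S` have
coefficients `0, 1`. -/
def IsPositiveFactorization (P S : Poly) (C : Finset (List Letter)) : Prop :=
  IsFactorization P S C ∧
    ((HasCoeffsZeroOne P ∧ HasCoeffsZeroOne S) ∨ (HasCoeffsZeroOne (-P) ∧ HasCoeffsZeroOne (-S)))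

end

end KrasnerCodes

namespace KrasnerCodes

open FreeMonoid

/-! Put A = a + b and X_r = (P_0 + ⋯ + P_r)(A - 1)S + 1. The heart of the matter is that X_r has
nonnegative coefficients (`coef_bTrunc_factorization_nonneg`). On words with at most r letters b it
agrees with C, and on words with at least r + 2 only the product (P_0 + ⋯ + P_r) b S contributes. On
words with r + 1 letters b, C exceeds X_r by P_{r+1}(a - 1)a^J. Multiplying on the right by a^I
turns this difference into P_{r+1}(a^n - 1), whose positive part is shifted by a^n. The words of X_r
in this layer end in b a^j with j ∈ J, and j < n. Uniqueness of sums in I + J then lets the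
coefficient of X_r be read off at exponent j, where the shifted part is absent, as a sum of
nonnegative terms (`IsKrasner.coeff_nonneg`).

Nonnegativity suffices for a code (`exists_isMaximalCode`). Since X_r has no constant term, S X_r^*
(P_0 + ⋯ + P_r) = A^*. Both outer factors have constant term 1, so X_r^* has coefficients at most 1,
which gives 0/1 coefficients and unique decodability. At a = b = 1/2 the factor A - 1 vanishes, so
the Kraft sum is 1 and the Kraft–McMillan inequality forbids adding a word. Power series over words
are handled by finite geometric sums, exact up to a given word length. -/

/-! ### Coefficients of noncommutative polynomials -/

theorem poly_ext {P Q : Poly} (h : ∀ w, coef P w = coef Q w) : P = Q :=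
  MonoidAlgebra.ext (Finsupp.ext h)

@[simp] theorem coef_zero (w : List Letter) : coef 0 w = 0 := rfl

@[simp] theorem coef_add (P Q : Poly) (w : List Letter) :
    coef (P + Q) w = coef P w + coef Q w := rfl

@[simp] theorem coef_neg (P : Poly) (w : List Letter) : coef (-P) w = -coef P w := by
  simp [coef]

@[simp] theorem coef_sub (P Q : Poly) (w : List Letter) :
    coef (P - Q) w = coef P w - coef Q w := by
  simp [coef]

@[simp] theorem coef_sum {ι : Type*} (s : Finset ι) (f : ι → Poly) (w : List Letter) :
    coef (∑ i ∈ s, f i) w = ∑ i ∈ s, coef (f i) w := by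
  simp [coef]

theorem coef_single (u : List Letter) (r : ℤ) (w : List Letter) :
    coef (MonoidAlgebra.single (ofList u) r) w = if u = w then r else 0 := by
  classical
  rw [coef, MonoidAlgebra.coeff_single, Finsupp.single_apply]
  simp

theorem coef_word (u w : List Letter) : coef (word u) w = if u = w then 1 else 0 :=
  coef_single u 1 w

theorem word_mul (u v : List Letter) : word u * word v = word (u ++ v) := by
  simp [word, FreeMonoid.ofList_append]

theorem word_nil : word [] = 1 := map_one (MonoidAlgebra.of ℤ (FreeMonoid Letter))

theorem coef_one (w : List Letter) : coef 1 w = if w = [] then 1 else 0 := by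
  rw [← word_nil, coef_word]; simp [eq_comm]

theorem coef_bPart (g : ℕ) (P : Poly) (w : List Letter) :
    coef (bPart g P) w = if w.count Letter.b = g then coef P w else 0 := by
  classical
  rw [coef, bPart, MonoidAlgebra.coeff_ofCoeff, Finsupp.filter_apply]
  simp only [FreeMonoid.toList_ofList]
  congr

/-- The coefficients of a product are obtained by cutting the word in all possible ways. -/
theorem coef_mul (P Q : Poly) (w : List Letter) :
    coef (P * Q) w = ∑ i ∈ Finset.range (w.length + 1), coef P (w.take i) * coef Q (w.drop i) := by
  induction P using MonoidAlgebra.induction_linear with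
  | zero => simp
  | add x y hx hy => simp [add_mul, hx, hy, Finset.sum_add_distrib]
  | single u r =>
    induction Q using MonoidAlgebra.induction_linear with
    | zero => simp
    | add x y hx hy => simp [mul_add, hx, hy, Finset.sum_add_distrib]
    | single v s =>
      obtain ⟨u, rfl⟩ := ofList.surjective u
      obtain ⟨v, rfl⟩ := ofList.surjective v
      rw [MonoidAlgebra.single_mul_single, ← FreeMonoid.ofList_append]
      simp only [coef_single]
      split_ifs with h
      · subst h
        rw [Finset.sum_eq_single_of_mem u.length (by simp)]
        · simp
        · intro i hi hne
          rw [if_neg, zero_mul]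
          intro h
          apply hne
          have := congrArg List.length h
          simp at this hi
          omega
      · refine (Finset.sum_eq_zero fun i _ => ?_).symm
        by_cases h1 : u = w.take i
        · rw [if_neg (c := v = _), mul_zero]
          rintro rfl
          exact h (by rw [h1, List.take_append_drop])
        · rw [if_neg h1, zero_mul]

theorem coef_mul_ne_zero {P Q : Poly} {w : List Letter} (h : coef (P * Q) w ≠ 0) :
    ∃ u v, w = u ++ v ∧ coef P u ≠ 0 ∧ coef Q v ≠ 0 := by
  rw [coef_mul] at h
  obtain ⟨i, -, hi⟩ := Finset.exists_ne_zero_of_sum_ne_zero h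
  exact ⟨_, _, (List.take_append_drop i w).symm, left_ne_zero_of_mul hi, right_ne_zero_of_mul hi⟩

theorem coef_mul_nonneg {P Q : Poly} (hP : ∀ w, 0 ≤ coef P w) (hQ : ∀ w, 0 ≤ coef Q w)
    (w : List Letter) : 0 ≤ coef (P * Q) w := by
  rw [coef_mul]
  exact Finset.sum_nonneg fun i _ => mul_nonneg (hP _) (hQ _)

theorem le_coef_mul {P Q : Poly} (hP : ∀ w, 0 ≤ coef P w) (hQ : ∀ w, 0 ≤ coef Q w)
    (u v : List Letter) : coef P u * coef Q v ≤ coef (P * Q) (u ++ v) := by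
  rw [coef_mul]
  refine le_trans (le_of_eq ?_) (Finset.single_le_sum (f := fun i =>
    coef P ((u ++ v).take i) * coef Q ((u ++ v).drop i))
    (fun i _ => mul_nonneg (hP _) (hQ _)) (a := u.length) (by simp))
  simp

/-- Distinct prefixes cut the word at distinct places, so they give separate terms of the
convolution. This is what detects a double factorization. -/
theorem add_le_coef_mul {P Q : Poly} (hP : ∀ w, 0 ≤ coef P w) (hQ : ∀ w, 0 ≤ coef Q w)
    {u v u' v' : List Letter} (h : u ++ v = u' ++ v') (hu : u ≠ u') :
    coef P u * coef Q v + coef P u' * coef Q v' ≤ coef (P * Q) (u ++ v) := by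
  have hlen : u.length ≠ u'.length := fun hl => hu (List.append_inj_left h hl)
  have hl := congrArg List.length h
  simp only [List.length_append] at hl
  have hsub : ({u.length, u'.length} : Finset ℕ) ⊆ Finset.range ((u ++ v).length + 1) := by
    intro i
    simp
    omega
  rw [coef_mul]
  refine le_trans (le_of_eq ?_) (Finset.sum_le_sum_of_subset_of_nonneg hsub
    fun i _ _ => mul_nonneg (hP _) (hQ _))
  rw [Finset.sum_pair hlen]
  congr 1
  · simp
  · rw [h]; simp

theorem coef_one_nonneg (w : List Letter) : 0 ≤ coef 1 w := by
  rw [coef_one]; split_ifs <;> simp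

theorem coef_word_nonneg (u w : List Letter) : 0 ≤ coef (word u) w := by
  rw [coef_word]; split_ifs <;> simp

theorem coef_pow_nonneg {P : Poly} (hP : ∀ w, 0 ≤ coef P w) (n : ℕ) :
    ∀ w, 0 ≤ coef (P ^ n) w := by
  induction n with
  | zero => simpa using coef_one_nonneg
  | succ n ih => rw [pow_succ]; exact coef_mul_nonneg ih hP

/-- Bound on the number of occurrences of `b` in the words of a polynomial. -/
def DegBLE (d : ℕ) (P : Poly) : Prop := ∀ w, coef P w ≠ 0 → w.count Letter.b ≤ d

theorem DegBLE.mul {d e : ℕ} {P Q : Poly} (hP : DegBLE d P) (hQ : DegBLE e Q) :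
    DegBLE (d + e) (P * Q) := by
  intro w hw
  obtain ⟨u, v, rfl, hu, hv⟩ := coef_mul_ne_zero hw
  rw [List.count_append]
  exact add_le_add (hP u hu) (hQ v hv)

theorem coef_charPoly (C : Finset (List Letter)) (w : List Letter) :
    coef (charPoly C) w = if w ∈ C then 1 else 0 := by
  simp [charPoly, coef_word]

/-- A polynomial with coefficients `0, 1` is the characteristic polynomial of a finite set. -/
theorem exists_charPoly_eq {X : Poly} (hX : HasCoeffsZeroOne X) :
    ∃ C : Finset (List Letter), charPoly C = X := by
  refine ⟨X.coeff.support.map ⟨FreeMonoid.toList, FreeMonoid.toList.injective⟩,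
    poly_ext fun w => ?_⟩
  rw [coef_charPoly]
  have : w ∈ X.coeff.support.map ⟨FreeMonoid.toList, FreeMonoid.toList.injective⟩ ↔
      coef X w ≠ 0 := by
    simp only [Finset.mem_map, Finsupp.mem_support_iff, Function.Embedding.coeFn_mk, coef]
    constructor
    · rintro ⟨v, hv, rfl⟩
      simpa using hv
    · intro h
      exact ⟨ofList w, h, by simp⟩
  simp only [this]
  rcases hX w with h | h <;> simp [h]

/-! ### Polynomials `X` with `X - 1 = P (A - 1) S` -/

/-- The polynomial has no term on words of length at most `N`. -/
def VanishesUpTo (N : ℕ) (P : Poly) : Prop := ∀ w : List Letter, w.length ≤ N → coef P w = 0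

theorem VanishesUpTo.mul_right {N : ℕ} {P : Poly} (h : VanishesUpTo N P) (Q : Poly) :
    VanishesUpTo N (P * Q) := by
  intro w hw
  rw [coef_mul]
  refine Finset.sum_eq_zero fun i _ => ?_
  rw [h _ (by simp; omega), zero_mul]

theorem VanishesUpTo.mul_left {N : ℕ} {P : Poly} (h : VanishesUpTo N P) (Q : Poly) :
    VanishesUpTo N (Q * P) := by
  intro w hw
  rw [coef_mul]
  refine Finset.sum_eq_zero fun i _ => ?_
  rw [h _ (by simp; omega), mul_zero]

/-- Without a constant term, each factor X uses at least one letter. -/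
theorem vanishesUpTo_pow_succ {X : Poly} (hX : coef X [] = 0) (N : ℕ) :
    VanishesUpTo N (X ^ (N + 1)) := by
  induction N with
  | zero =>
    intro w hw
    obtain rfl : w = [] := List.length_eq_zero_iff.1 (by omega)
    simpa using hX
  | succ N ih =>
    intro w hw
    rw [pow_succ', coef_mul]
    refine Finset.sum_eq_zero fun i hi => ?_
    rcases Nat.eq_zero_or_pos i with rfl | hi'
    · simp [hX]
    · rw [ih _ (by simp; omega), mul_zero]

/-- A polynomial with nonzero constant term can be cancelled modulo long words. -/
theorem VanishesUpTo.of_mul {N : ℕ} {P Q : Poly} (hP : coef P [] ≠ 0)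
    (h : VanishesUpTo N (P * Q)) : VanishesUpTo N Q := by
  intro w
  induction hn : w.length using Nat.strong_induction_on generalizing w with
  | _ m ih =>
    intro hw
    have h1 := h w (by omega)
    rw [coef_mul, Finset.sum_eq_single_of_mem 0 (by simp)] at h1
    · simpa [hP] using h1
    -- A nonempty prefix leaves a strictly shorter suffix, on which Q already vanishes.
    · intro i hi hne
      simp at hi
      rw [ih _ (by simp; omega) (w.drop i) rfl (by simp; omega), mul_zero]

theorem coef_polyA_add_polyB (w : List Letter) :
    coef (polyA + polyB) w = if w.length = 1 then 1 else 0 := by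
  simp only [polyA, polyB, coef_add, coef_word]
  match w with
  | [] => simp
  | [Letter.a] => simp
  | [Letter.b] => simp
  | _ :: _ :: _ => simp

theorem coef_alphabet_pow (i : ℕ) (w : List Letter) :
    coef ((polyA + polyB) ^ i) w = if w.length = i then 1 else 0 := by
  induction i generalizing w with
  | zero => simp [coef_one]
  | succ i ih =>
    rw [pow_succ', coef_mul]
    simp only [ih, coef_polyA_add_polyB, List.length_take, List.length_drop]
    by_cases h : w.length = i + 1
    · rw [if_pos h, Finset.sum_eq_single_of_mem 1 (by simp [h])]
      · simp [h]
      · intro j hj hne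
        simp at hj
        rw [if_neg (by omega), zero_mul]
    · rw [if_neg h]
      refine Finset.sum_eq_zero fun j hj => ?_
      simp at hj
      split_ifs <;> omega

/-- If `X = P (A - 1) S + 1` has no constant term, then `S X* P = A*`, up to long words. -/
theorem coef_mul_geom_mul {P S X : Poly} (hX : X = P * (polyA + polyB - 1) * S + 1)
    (hX0 : coef X [] = 0) (N : ℕ) {w : List Letter} (hw : w.length ≤ N) :
    coef (S * (∑ i ∈ Finset.range (N + 1), X ^ i) * P) w = 1 := by
  set H := ∑ i ∈ Finset.range (N + 1), X ^ i with hH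
  set A := polyA + polyB with hA
  set G := ∑ i ∈ Finset.range (N + 1), A ^ i with hG
  have hgX : (1 - X) * H = 1 - X ^ (N + 1) := mul_neg_geom_sum X (N + 1)
  have hgA : G * (1 - A) = 1 - A ^ (N + 1) := geom_sum_mul_neg A (N + 1)
  -- The constant term of X is 1 minus the product of the constant terms of P and S.
  have hP0 : coef P [] ≠ 0 := by
    intro h
    rw [hX, mul_assoc, coef_add, coef_mul] at hX0
    simp [h, coef_one] at hX0
  -- Keeping P on the left allows (1 - A)SHP = 1 to be obtained by cancelling P up to length N.
  -- Multiplying by G then inverts 1 - A.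
  have key : P * ((1 - A) * S * H * P - 1) = -(X ^ (N + 1) * P) := by
    have h1 : P * (1 - A) * S = 1 - X := by rw [hX]; noncomm_ring
    calc P * ((1 - A) * S * H * P - 1) = (P * (1 - A) * S) * H * P - P := by noncomm_ring
      _ = -(X ^ (N + 1) * P) := by rw [h1, hgX]; noncomm_ring
  have hvX : VanishesUpTo N (X ^ (N + 1) * P) := (vanishesUpTo_pow_succ hX0 N).mul_right P
  have hv1 : VanishesUpTo N ((1 - A) * S * H * P - 1) := by
    refine VanishesUpTo.of_mul hP0 ?_
    rw [key]
    intro v hv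
    rw [coef_neg, hvX v hv, neg_zero]
  have hv2 := hv1.mul_left G w hw
  have h2 : G * ((1 - A) * S * H * P - 1) = S * H * P - A ^ (N + 1) * (S * H * P) - G := by
    calc G * ((1 - A) * S * H * P - 1) = (G * (1 - A)) * (S * H * P) - G := by noncomm_ring
      _ = _ := by rw [hgA]; noncomm_ring
  have hA0 : coef A [] = 0 := by rw [hA, coef_polyA_add_polyB]; simp
  have h3 := (vanishesUpTo_pow_succ hA0 N).mul_right (S * H * P) w hw
  have h4 : coef G w = 1 := by
    rw [hG, coef_sum, Finset.sum_congr rfl fun i _ => coef_alphabet_pow i w]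
    simp; omega
  rw [h2, coef_sub, coef_sub, h3, h4] at hv2
  linarith

/-- Inserting w between the empty words of S and P shows that its coefficient in X^* is at most its
coefficient in S X^* P = A^*, which is 1. -/
theorem coef_geom_le_one {P S X : Poly} (hX : X = P * (polyA + polyB - 1) * S + 1)
    (hP : ∀ w, 0 ≤ coef P w) (hS : ∀ w, 0 ≤ coef S w) (hXn : ∀ w, 0 ≤ coef X w)
    (hX0 : coef X [] = 0) (N : ℕ) (w : List Letter) :
    coef (∑ i ∈ Finset.range (N + 1), X ^ i) w ≤ 1 := by
  have hPS : coef P [] * coef S [] = 1 := by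
    rw [hX, coef_add, coef_mul] at hX0
    simp [coef_mul, coef_one, -coef_add, coef_polyA_add_polyB] at hX0
    linarith
  have hP1 : 1 ≤ coef P [] := by
    have := hP []
    by_contra h
    have : coef P [] = 0 := by omega
    simp [this] at hPS
  have hS1 : 1 ≤ coef S [] := by
    have := hS []
    by_contra h
    have : coef S [] = 0 := by omega
    simp [this] at hPS
  have hHn : ∀ N v, 0 ≤ coef (∑ i ∈ Finset.range N, X ^ i) v := fun N v => by
    rw [coef_sum]
    exact Finset.sum_nonneg fun i _ => coef_pow_nonneg hXn i v
  -- The identity needs a truncation order at least the length of w; adding powers of X only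
  -- increases coefficients.
  set K := max N w.length with hK
  have h1 : coef (∑ i ∈ Finset.range (N + 1), X ^ i) w ≤
      coef (∑ i ∈ Finset.range (K + 1), X ^ i) w := by
    rw [coef_sum, coef_sum]
    refine Finset.sum_le_sum_of_subset_of_nonneg ?_ fun i _ _ => coef_pow_nonneg hXn i w
    intro i
    simp
    omega
  have h2 := coef_mul_geom_mul hX hX0 K (w := w) (le_max_right _ _)
  have h3 := le_coef_mul (coef_mul_nonneg hS (hHn (K + 1))) hP w []
  have h4 := le_coef_mul hS (hHn (K + 1)) [] w
  rw [List.append_nil, h2] at h3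
  rw [List.nil_append] at h4
  have h5 := hHn (K + 1) w
  nlinarith [coef_mul_nonneg hS (hHn (K + 1)) w]

theorem hasCoeffsZeroOne_of_factorization {P S X : Poly}
    (hX : X = P * (polyA + polyB - 1) * S + 1)
    (hP : ∀ w, 0 ≤ coef P w) (hS : ∀ w, 0 ≤ coef S w) (hXn : ∀ w, 0 ≤ coef X w)
    (hX0 : coef X [] = 0) : HasCoeffsZeroOne X := by
  intro w
  -- Order 1 suffices: the sum is 1 + X.
  have h := coef_geom_le_one hX hP hS hXn hX0 1 w
  have h1 := hXn w
  have h2 := coef_one_nonneg w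
  simp [Finset.sum_range_succ] at h
  omega

/-! ### Unique decodability and maximality -/

/-- A factorization into i words of C contributes to the i-th power of the characteristic
polynomial. -/
theorem one_le_coef_geom {C : Finset (List Letter)} (L : List (List Letter))
    (hL : ∀ w ∈ L, w ∈ C) (N : ℕ) (hN : L.length ≤ N) :
    1 ≤ coef (∑ i ∈ Finset.range (N + 1), charPoly C ^ i) L.flatten := by
  have hn : ∀ w, 0 ≤ coef (charPoly C) w := fun w => by
    rw [coef_charPoly]; split_ifs <;> simp
  induction L generalizing N with
  | nil =>
    rw [Finset.sum_range_succ', coef_add, coef_sum]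
    have := Finset.sum_nonneg (s := Finset.range N) fun i _ =>
      coef_pow_nonneg hn (i + 1) ([] : List (List Letter)).flatten
    simp [coef_one] at this ⊢
    exact this
  | cons u L ih =>
    obtain ⟨N, rfl⟩ : ∃ K, N = K + 1 := ⟨N - 1, by simp at hN; omega⟩
    rw [geom_sum_succ, coef_add, List.flatten_cons]
    have h1 := le_coef_mul hn (Q := ∑ i ∈ Finset.range (N + 1), charPoly C ^ i) (fun v => by
      rw [coef_sum]; exact Finset.sum_nonneg fun i _ => coef_pow_nonneg hn i v) u L.flatten
    have h2 := ih (fun w hw => hL w (by simp [hw])) N (by simpa using hN)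
    have h3 : coef (charPoly C) u = 1 := by
      rw [coef_charPoly, if_pos (hL u (by simp))]
    have h4 := coef_one_nonneg (u ++ L.flatten)
    rw [h3] at h1
    linarith

theorem uniquelyDecodable_of_coef_geom_le_one {C : Finset (List Letter)}
    (h0 : [] ∉ C)
    (h : ∀ N w, coef (∑ i ∈ Finset.range (N + 1), charPoly C ^ i) w ≤ 1) :
    InformationTheory.UniquelyDecodable (C : Set (List Letter)) := by
  have hn : ∀ w, 0 ≤ coef (charPoly C) w := fun w => by
    rw [coef_charPoly]; split_ifs <;> simp
  have hne : ∀ (u : List Letter) (L : List (List Letter)),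
      (∀ w ∈ u :: L, w ∈ (C : Set (List Letter))) →
      (u :: L).flatten ≠ [] := by
    intro u L hL hf
    have hu : u = [] := by simp at hf; exact hf.1
    have := hL u (by simp)
    rw [hu] at this
    exact h0 (by simpa using this)
  intro L₁
  induction L₁ with
  | nil =>
    intro L₂ _ h₂ hf
    cases L₂ with
    | nil => rfl
    | cons v L₂ => exact absurd hf.symm (hne v L₂ h₂)
  | cons u L₁ ih =>
    intro L₂ h₁ h₂ hf
    cases L₂ with
    | nil => exact absurd hf (hne u L₁ h₁)
    | cons v L₂ =>
      have h₁' : ∀ w ∈ L₁, w ∈ C := fun w hw => by simpa using h₁ w (by simp [hw])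
      have h₂' : ∀ w ∈ L₂, w ∈ C := fun w hw => by simpa using h₂ w (by simp [hw])
      have hu : u ∈ C := by simpa using h₁ u (by simp)
      have hv : v ∈ C := by simpa using h₂ v (by simp)
      rw [List.flatten_cons, List.flatten_cons] at hf
      by_cases huv : u = v
      · subst huv
        rw [ih L₂ (by simpa using h₁') (by simpa using h₂') (by simpa using hf)]
      · exfalso
        set N := max L₁.length L₂.length
        have k1 := one_le_coef_geom L₁ h₁' N (le_max_left _ _)
        have k2 := one_le_coef_geom L₂ h₂' N (le_max_right _ _)
        -- Different first words would give the common message a coefficient of at least 2.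
        have k3 := add_le_coef_mul hn (Q := ∑ i ∈ Finset.range (N + 1), charPoly C ^ i) (fun v => by
          rw [coef_sum]; exact Finset.sum_nonneg fun i _ => coef_pow_nonneg hn i v) hf huv
        have k4 := h (N + 1) (u ++ L₁.flatten)
        rw [geom_sum_succ, coef_add] at k4
        have k5 := coef_one_nonneg (u ++ L₁.flatten)
        rw [coef_charPoly, coef_charPoly, if_pos hu, if_pos hv] at k3
        linarith

instance : Fintype Letter where
  elems := {Letter.a, Letter.b}
  complete x := by cases x <;> simp

instance : Nonempty Letter := ⟨Letter.a⟩

theorem card_letter : Fintype.card Letter = 2 := rfl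

/-- The ring homomorphism `ℤ⟨A⟩ → ℝ` sending both letters to `1/2`. -/
noncomputable def evalHalf : Poly →+* ℝ :=
  (MonoidAlgebra.lift ℤ ℝ (FreeMonoid Letter)
    (FreeMonoid.lift fun _ : Letter => (1 / 2 : ℝ))).toRingHom

theorem evalHalf_word (w : List Letter) : evalHalf (word w) = (1 / 2 : ℝ) ^ w.length := by
  have : evalHalf (word w) = FreeMonoid.lift (fun _ : Letter => (1 / 2 : ℝ)) (ofList w) := by
    simp [evalHalf, word]
  rw [this, FreeMonoid.lift_apply]
  simp

/-- A code `C` with `C = P (A - 1) S + 1` is maximal. -/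
theorem isMaximalCode_of_factorization {C : Finset (List Letter)} {P S : Poly}
    (hC : charPoly C = P * (polyA + polyB - 1) * S + 1)
    (hu : InformationTheory.UniquelyDecodable (C : Set (List Letter))) : IsMaximalCode C := by
  -- The factor a + b - 1 evaluates to 0 at a = b = 1/2.
  have hsum : ∑ w ∈ C, (1 / 2 : ℝ) ^ w.length = 1 := by
    have := congrArg evalHalf hC
    simp only [charPoly, map_sum, map_add, map_mul, map_sub, map_one, evalHalf_word, polyA,
      polyB] at this
    rw [this]
    norm_num
  refine ⟨hu, fun D hD hCD w hw => ?_⟩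
  by_contra hwC
  have hwC' : w ∉ C := by simpa using hwC
  have hsub : ((insert w C : Finset (List Letter)) : Set (List Letter)) ⊆ D := by
    rw [Finset.coe_insert]
    exact Set.insert_subset hw hCD
  have hins : InformationTheory.UniquelyDecodable
      ((insert w C : Finset (List Letter)) : Set (List Letter)) :=
    fun L₁ L₂ h₁ h₂ => hD L₁ L₂ (fun v hv => hsub (h₁ v hv)) (fun v hv => hsub (h₂ v hv))
  have hk := InformationTheory.kraft_mcmillan_inequality hins
  rw [Finset.sum_insert hwC', card_letter] at hk
  have hpos : (0 : ℝ) < (1 / 2) ^ w.length := by positivity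
  push_cast at hk
  linarith

/-- If `P (A - 1) S + 1` has nonnegative coefficients and no constant term, where `P, S` have
nonnegative coefficients, then it is the characteristic polynomial of a finite maximal code. -/
theorem exists_isMaximalCode {P S X : Poly}
    (hX : X = P * (polyA + polyB - 1) * S + 1)
    (hP : ∀ w, 0 ≤ coef P w) (hS : ∀ w, 0 ≤ coef S w) (hXn : ∀ w, 0 ≤ coef X w)
    (hX0 : coef X [] = 0) : ∃ C, IsMaximalCode C ∧ charPoly C = X := by
  obtain ⟨C, rfl⟩ := exists_charPoly_eq (hasCoeffsZeroOne_of_factorization hX hP hS hXn hX0)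
  refine ⟨C, isMaximalCode_of_factorization hX
    (uniquelyDecodable_of_coef_geom_le_one ?_ (coef_geom_le_one hX hP hS hXn hX0)), rfl⟩
  intro h
  rw [coef_charPoly, if_pos h] at hX0
  exact one_ne_zero hX0


/-! ### Coefficients along powers of `a` -/

/-- The generating series of the coefficients of `Q` on the words `u a^m`. -/
noncomputable def aSeries (u : List Letter) (Q : Poly) : PowerSeries ℤ :=
  PowerSeries.mk fun m => coef Q (u ++ List.replicate m Letter.a)

theorem coeff_aSeries (u : List Letter) (Q : Poly) (m : ℕ) :
    PowerSeries.coeff m (aSeries u Q) = coef Q (u ++ List.replicate m Letter.a) :=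
  PowerSeries.coeff_mk _ _

/-- If no proper prefix of `u` is in the support of `D`, the series of `D T` along `u` is a
product. -/
theorem aSeries_mul {u : List Letter} {D : Poly} (T : Poly)
    (h : ∀ i < u.length, coef D (u.take i) = 0) :
    aSeries u (D * T) = aSeries u D * aSeries [] T := by
  ext m
  rw [coeff_aSeries, coef_mul, PowerSeries.coeff_mul,
    Finset.Nat.sum_antidiagonal_eq_sum_range_succ
      (fun i j => PowerSeries.coeff i (aSeries u D) * PowerSeries.coeff j (aSeries [] T)),
    List.length_append, List.length_replicate, add_assoc, Finset.sum_range_add,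
    Finset.sum_eq_zero, zero_add]
  · refine Finset.sum_congr rfl fun i hi => ?_
    have hi' : i ≤ m := by simpa [Nat.lt_succ_iff] using hi
    rw [coeff_aSeries, coeff_aSeries, List.take_length_add_append, List.drop_length_add_append,
      List.take_replicate, List.drop_replicate, min_eq_left hi', List.nil_append]
  · intro i hi
    have hi' : i < u.length := by simpa using hi
    rw [List.take_append_of_le_length hi'.le, h i hi', zero_mul]

theorem aSeries_nil_mul (P Q : Poly) : aSeries [] (P * Q) = aSeries [] P * aSeries [] Q :=
  aSeries_mul Q (by simp)

theorem aSeries_add (u : List Letter) (P Q : Poly) :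
    aSeries u (P + Q) = aSeries u P + aSeries u Q := by
  ext m; simp [coeff_aSeries]

theorem polyA_pow (j : ℕ) : polyA ^ j = word (List.replicate j Letter.a) := by
  induction j with
  | zero => rw [pow_zero, List.replicate_zero, word_nil]
  | succ j ih => rw [pow_succ', ih, polyA, word_mul]; rfl

theorem coef_aPow_replicate (H : Finset ℕ) (m : ℕ) :
    coef (aPow H) (List.replicate m Letter.a) = if m ∈ H then 1 else 0 := by
  simp [aPow, polyA_pow, coef_word, List.replicate_inj]

theorem aSeries_polyA : aSeries [] polyA = PowerSeries.X := by
  ext m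
  have := coef_aPow_replicate {1} m
  simp only [aPow, Finset.sum_singleton, pow_one, Finset.mem_singleton] at this
  rw [coeff_aSeries, PowerSeries.coeff_X, List.nil_append, this]

theorem aSeries_polyB : aSeries [] polyB = 0 := by
  ext m
  rw [coeff_aSeries, polyB, coef_word, if_neg, map_zero]
  intro h
  have := congrArg (List.count Letter.b) h
  simp [List.count_replicate] at this

theorem aSeries_one : aSeries [] 1 = 1 := by
  ext m
  rw [coeff_aSeries, coef_one, PowerSeries.coeff_one]
  simp

/-- The ring homomorphism `ℤ⟨A⟩ → ℤ⟦X⟧` with `a ↦ X`, `b ↦ 0`. -/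
noncomputable def aSeriesHom : Poly →+* PowerSeries ℤ where
  toFun := aSeries []
  map_one' := aSeries_one
  map_mul' := aSeries_nil_mul
  map_zero' := by ext m; simp [coeff_aSeries]
  map_add' := aSeries_add []

theorem aSeriesHom_aPow (H : Finset ℕ) :
    aSeriesHom (aPow H) = ∑ h ∈ H, (PowerSeries.X : PowerSeries ℤ) ^ h := by
  have : aSeriesHom polyA = PowerSeries.X := aSeries_polyA
  simp [aPow, this]

/-! ### Krasner factorizations -/

/-- The series `∑_{h ∈ H} X^h`. -/
noncomputable def xPow (H : Finset ℕ) : PowerSeries ℤ := ∑ h ∈ H, PowerSeries.X ^ h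

theorem coeff_xPow (H : Finset ℕ) (m : ℕ) :
    PowerSeries.coeff m (xPow H) = if m ∈ H then 1 else 0 := by
  simp [xPow, PowerSeries.coeff_X_pow]

theorem IsKrasner.xPow_mul {n : ℕ} {I J : Finset ℕ} (h : IsKrasner n I J) :
    xPow I * xPow J = xPow (Finset.range n) := by
  have := congrArg aSeriesHom h.2
  rwa [map_mul, aSeriesHom_aPow, aSeriesHom_aPow, aSeriesHom_aPow] at this

theorem IsKrasner.coeff_sum {n : ℕ} {I J : Finset ℕ} (h : IsKrasner n I J) (m : ℕ) :
    ∑ p ∈ Finset.HasAntidiagonal.antidiagonal m,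
        (if p.1 ∈ I then (1 : ℤ) else 0) * (if p.2 ∈ J then 1 else 0) =
      if m < n then 1 else 0 := by
  have := congrArg (PowerSeries.coeff m) h.xPow_mul
  simpa only [PowerSeries.coeff_mul, coeff_xPow, Finset.mem_range] using this

theorem IsKrasner.zero_mem {n : ℕ} {I J : Finset ℕ} (h : IsKrasner n I J) :
    0 ∈ I ∧ 0 ∈ J := by
  have := h.coeff_sum 0
  rw [if_pos h.1] at this
  by_contra hc
  rw [not_and_or] at hc
  rcases hc with hc | hc <;> simp [hc] at this

theorem IsKrasner.add_lt {n : ℕ} {I J : Finset ℕ} (h : IsKrasner n I J) {i j : ℕ}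
    (hi : i ∈ I) (hj : j ∈ J) : i + j < n := by
  by_contra hn
  have hs := h.coeff_sum (i + j)
  rw [if_neg hn, Finset.sum_eq_zero_iff_of_nonneg] at hs
  · simpa [hi, hj] using hs (i, j) (by simp)
  · intro p _
    split_ifs <;> simp

/-- Two representations would make a coefficient of the product at least 2, while all coefficients
are 0 or 1. -/
theorem IsKrasner.unique {n : ℕ} {I J : Finset ℕ} (h : IsKrasner n I J) {i j i' j' : ℕ}
    (hi : i ∈ I) (hj : j ∈ J) (hi' : i' ∈ I) (hj' : j' ∈ J) (he : i + j = i' + j') : i = i' := by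
  by_contra hne
  have hs := h.coeff_sum (i + j)
  rw [if_pos (h.add_lt hi hj)] at hs
  have hsub : ({(i, j), (i', j')} : Finset (ℕ × ℕ)) ⊆
      Finset.HasAntidiagonal.antidiagonal (i + j) := by
    intro p
    simp only [Finset.mem_insert, Finset.mem_singleton, Finset.HasAntidiagonal.mem_antidiagonal]
    rintro (rfl | rfl)
    · rfl
    · exact he.symm
  have := Finset.sum_le_sum_of_subset_of_nonneg
    (f := fun p : ℕ × ℕ => (if p.1 ∈ I then (1 : ℤ) else 0) * (if p.2 ∈ J then 1 else 0)) hsub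
    fun p _ _ => by split_ifs <;> simp
  rw [hs, Finset.sum_pair (by simp [hne])] at this
  simp [hi, hj, hi', hj'] at this

/-- If `Y` is supported in `J` and `Y + (X - 1) L X^J` and `L` are nonnegative, then so is `Y`. -/
theorem IsKrasner.coeff_nonneg {n : ℕ} {I J : Finset ℕ} (h : IsKrasner n I J)
    {Y L Z : PowerSeries ℤ} (hYJ : ∀ m ∉ J, PowerSeries.coeff m Y = 0)
    (hL : ∀ m, 0 ≤ PowerSeries.coeff m L) (hZ : ∀ m, 0 ≤ PowerSeries.coeff m Z)
    (hYZ : Z = Y + L * ((PowerSeries.X - 1) * xPow J)) (m : ℕ) : 0 ≤ PowerSeries.coeff m Y := by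
  by_cases hm : m ∈ J
  swap
  · rw [hYJ m hm]
  have hI := h.zero_mem.1
  have hgeom : (PowerSeries.X - 1) * (xPow I * xPow J) = PowerSeries.X ^ n - 1 := by
    rw [h.xPow_mul, xPow]
    exact mul_geom_sum _ _
  -- Multiplication by X^I collapses (X - 1)X^J to X^n - 1.
  have key : xPow I * Y = xPow I * Z + L - L * PowerSeries.X ^ n := by
    linear_combination -(xPow I) * hYZ - L * hgeom
  have h1 := congrArg (PowerSeries.coeff m) key
  have hmn : m < n := by simpa using h.add_lt hI hm
  -- Since m < n, the only negative term, L X^n, does not reach exponent m. On the left only the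
  -- pair (0, m) survives.
  rw [map_sub, map_add, PowerSeries.coeff_mul_X_pow', if_neg (by omega), sub_zero,
    PowerSeries.coeff_mul, PowerSeries.coeff_mul,
    Finset.sum_eq_single_of_mem (0, m) (by simp)] at h1
  · simp only [coeff_xPow, hI, if_true, one_mul] at h1
    rw [h1]
    refine add_nonneg (Finset.sum_nonneg fun p _ => mul_nonneg ?_ (hZ _)) (hL m)
    split_ifs <;> simp
  · intro p hp hne
    rw [coeff_xPow]
    by_cases hp1 : p.1 ∈ I
    · by_cases hp2 : p.2 ∈ J
      · rw [Finset.HasAntidiagonal.mem_antidiagonal] at hp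
        have := h.unique hp1 hp2 hI hm (by simpa using hp)
        exact absurd (Prod.ext this (by simp; omega)) hne
      · rw [hYJ _ hp2, mul_zero]
    · rw [if_neg hp1, zero_mul]

/-! ### The polynomial `S` -/

/-- The polynomial `a^J + ∑_{j ∈ J} a^{M_j} b a^j`. -/
noncomputable def krasnerPoly (J : Finset ℕ) (M : ℕ → Finset ℕ) : Poly :=
  aPow J + ∑ j ∈ J, aPow (M j) * polyB * polyA ^ j

theorem krasnerPoly_eq (J : Finset ℕ) (M : ℕ → Finset ℕ) :
    krasnerPoly J M = ∑ j ∈ J, word (List.replicate j Letter.a) +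
      ∑ j ∈ J, ∑ m ∈ M j, word (List.replicate m Letter.a ++ Letter.b ::
        List.replicate j Letter.a) := by
  simp [krasnerPoly, aPow, polyA_pow, polyB, Finset.sum_mul, word_mul]

theorem coef_krasnerPoly_nonneg (J : Finset ℕ) (M : ℕ → Finset ℕ) (w : List Letter) :
    0 ≤ coef (krasnerPoly J M) w := by
  rw [krasnerPoly_eq, coef_add, coef_sum, coef_sum]
  refine add_nonneg (Finset.sum_nonneg fun j _ => coef_word_nonneg _ _)
    (Finset.sum_nonneg fun j _ => ?_)
  rw [coef_sum]
  exact Finset.sum_nonneg fun j _ => coef_word_nonneg _ _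

theorem exists_of_coef_krasnerPoly_ne_zero {J : Finset ℕ} {M : ℕ → Finset ℕ} {w : List Letter}
    (h : coef (krasnerPoly J M) w ≠ 0) : ∃ j ∈ J, w = List.replicate j Letter.a ∨
      ∃ m, w = List.replicate m Letter.a ++ Letter.b :: List.replicate j Letter.a := by
  rw [krasnerPoly_eq, coef_add, coef_sum, coef_sum] at h
  by_cases h1 : ∑ j ∈ J, coef (word (List.replicate j Letter.a)) w = 0
  · rw [h1, zero_add] at h
    obtain ⟨j, hj, h⟩ := Finset.exists_ne_zero_of_sum_ne_zero h
    rw [coef_sum] at h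
    obtain ⟨m, -, h⟩ := Finset.exists_ne_zero_of_sum_ne_zero h
    rw [coef_word] at h
    exact ⟨j, hj, Or.inr ⟨m, by by_contra hc; exact h (if_neg fun e => hc e.symm)⟩⟩
  · obtain ⟨j, hj, h⟩ := Finset.exists_ne_zero_of_sum_ne_zero h1
    rw [coef_word] at h
    exact ⟨j, hj, Or.inl (by by_contra hc; exact h (if_neg fun e => hc e.symm))⟩

theorem degBLE_krasnerPoly (J : Finset ℕ) (M : ℕ → Finset ℕ) : DegBLE 1 (krasnerPoly J M) := by
  intro w hw
  obtain ⟨j, -, rfl | ⟨m, rfl⟩⟩ := exists_of_coef_krasnerPoly_ne_zero hw <;>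
    simp [List.count_replicate]

theorem degBLE_polyA_sub_one : DegBLE 0 (polyA - 1) := by
  intro w hw
  by_contra hc
  apply hw
  rw [coef_sub, polyA, coef_word, coef_one, if_neg, if_neg, sub_zero] <;>
    (rintro rfl; simp at hc)

theorem degBLE_polyB : DegBLE 1 polyB := by
  intro w hw
  rw [polyB, coef_word] at hw
  split_ifs at hw with h
  · subst h; simp
  · exact absurd rfl hw

theorem degBLE_alphabet_sub_one : DegBLE 1 (polyA + polyB - 1) := by
  intro w hw
  by_cases h : coef polyB w = 0
  · refine (degBLE_polyA_sub_one w fun h' => hw ?_).trans zero_le_one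
    rw [coef_sub] at h'
    rw [coef_sub, coef_add]
    omega
  · exact degBLE_polyB w h

/-- Both exponents count the letters a after the last b. -/
theorem append_cons_replicate_inj {v v' : List Letter} {m j : ℕ}
    (h : v ++ Letter.b :: List.replicate m Letter.a =
      v' ++ Letter.b :: List.replicate j Letter.a) : m = j := by
  have h' := congrArg (fun l => l.reverse.takeWhile (· = Letter.a)) h
  have h2 := congrArg List.length h'
  simpa [List.takeWhile_append_of_pos, List.takeWhile_append] using h2

/-- The words of `(A - 1) S` containing `b` end in `b a^j` with `j ∈ J`. -/
theorem coef_alphabet_mul_krasnerPoly {J : Finset ℕ} {M : ℕ → Finset ℕ} {m : ℕ} (hm : m ∉ J)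
    (v : List Letter) : coef ((polyA + polyB - 1) * krasnerPoly J M)
      (v ++ Letter.b :: List.replicate m Letter.a) = 0 := by
  by_contra h
  obtain ⟨u, s, he, hu, hs⟩ := coef_mul_ne_zero h
  obtain ⟨j, hj, rfl | ⟨i, rfl⟩⟩ := exists_of_coef_krasnerPoly_ne_zero hs
  · have hlen : u.length ≤ 1 := by
      by_contra hc
      apply hu
      rw [coef_sub, coef_polyA_add_polyB, coef_one, if_neg (by omega), if_neg, sub_zero]
      rintro rfl
      simp at hc
    match u with
    | [] =>
      have := congrArg (List.count Letter.b) he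
      simp [List.count_replicate] at this
    | [Letter.a] =>
      have := congrArg (List.count Letter.b) he
      simp [List.count_replicate] at this
    | [Letter.b] =>
      exact hm (append_cons_replicate_inj (v' := []) he ▸ hj)
    | _ :: _ :: _ => simp at hlen
  · rw [← List.append_assoc] at he
    exact hm (append_cons_replicate_inj he ▸ hj)

theorem aSeries_alphabet_mul_krasnerPoly (J : Finset ℕ) (M : ℕ → Finset ℕ) :
    aSeries [] ((polyA + polyB - 1) * krasnerPoly J M) = (PowerSeries.X - 1) * xPow J := by
  have hB : aSeriesHom polyB = 0 := aSeries_polyB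
  have hA : aSeriesHom polyA = PowerSeries.X := aSeries_polyA
  change aSeriesHom _ = _
  rw [krasnerPoly, map_mul, map_sub, map_add, map_add, map_sum]
  simp [hA, hB, aSeriesHom_aPow, xPow]

/-! ### Truncation of the left factor -/

/-- The part of `P` supported on the words with at most `r` occurrences of `b`. -/
noncomputable def bTrunc (r : ℕ) (P : Poly) : Poly := ∑ g ∈ Finset.range (r + 1), bPart g P

theorem coef_bTrunc (r : ℕ) (P : Poly) (w : List Letter) :
    coef (bTrunc r P) w = if w.count Letter.b ≤ r then coef P w else 0 := by
  simp [bTrunc, coef_bPart]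

theorem degBLE_bTrunc (r : ℕ) (P : Poly) : DegBLE r (bTrunc r P) := by
  intro w hw
  rw [coef_bTrunc] at hw
  by_contra hc
  exact hw (if_neg hc)

/-- Every word of the left factor already has more than r letters b. -/
theorem coef_sub_bTrunc_mul {r : ℕ} (P T : Poly) {w : List Letter} (hw : w.count Letter.b ≤ r) :
    coef ((P - bTrunc r P) * T) w = 0 := by
  by_contra h
  obtain ⟨u, v, rfl, hu, -⟩ := coef_mul_ne_zero h
  rw [List.count_append] at hw
  rw [coef_sub, coef_bTrunc, if_pos (by omega), sub_self] at hu
  exact hu rfl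

/-- A word with `r + 1` occurrences of `b` factors as `u b a^m` at its last `b`. -/
theorem exists_eq_append_cons_replicate {r : ℕ} {w : List Letter}
    (hw : w.count Letter.b = r + 1) :
    ∃ u m, w = u ++ Letter.b :: List.replicate m Letter.a ∧ u.count Letter.b = r := by
  induction w using List.reverseRecOn with
  | nil => simp at hw
  | append_singleton w x ih =>
    cases x with
    | a =>
      obtain ⟨u, m, rfl, hu⟩ := ih (by simpa using hw)
      exact ⟨u, m + 1, by simp [List.replicate_succ'], hu⟩
    | b => exact ⟨w, 0, by simp, by simpa using hw⟩

/-- The coefficients of `(P_0 + ⋯ + P_r) (A - 1) S + 1` are nonnegative when those of `P` and of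
`P (A - 1) S + 1` are. -/
theorem coef_bTrunc_factorization_nonneg {n : ℕ} {I J : Finset ℕ} (hIJ : IsKrasner n I J)
    (M : ℕ → Finset ℕ) {P : Poly} (hP : ∀ w, 0 ≤ coef P w)
    (hX : ∀ w, 0 ≤ coef (P * (polyA + polyB - 1) * krasnerPoly J M + 1) w) (r : ℕ)
    (w : List Letter) :
    0 ≤ coef (bTrunc r P * (polyA + polyB - 1) * krasnerPoly J M + 1) w := by
  have hPr : ∀ w, 0 ≤ coef (bTrunc r P) w := fun w => by
    rw [coef_bTrunc]; split_ifs; exacts [hP w, le_rfl]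
  have hsplit : P * (polyA + polyB - 1) * krasnerPoly J M + 1 =
      (bTrunc r P * (polyA + polyB - 1) * krasnerPoly J M + 1) +
        (P - bTrunc r P) * ((polyA + polyB - 1) * krasnerPoly J M) := by
    noncomm_ring
  rcases lt_trichotomy (w.count Letter.b) (r + 1) with hw | hw | hw
  · have h := hX w
    rwa [hsplit, coef_add, coef_sub_bTrunc_mul P _ (by omega), add_zero] at h
  · obtain ⟨u, m, rfl, hu⟩ := exists_eq_append_cons_replicate hw
    -- Proper prefixes of u b contain at most r letters b, so P minus its truncation vanishes on
    -- them.
    have hmul := aSeries_mul (u := u ++ [Letter.b]) (D := P - bTrunc r P)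
      ((polyA + polyB - 1) * krasnerPoly J M) (by
        intro i hi
        have hi' : i ≤ u.length := by simpa [Nat.lt_succ_iff] using hi
        rw [List.take_append_of_le_length hi', coef_sub, coef_bTrunc, if_pos, sub_self]
        exact hu ▸ (List.take_sublist i u).count_le _)
    rw [aSeries_alphabet_mul_krasnerPoly] at hmul
    have := hIJ.coeff_nonneg
      (Y := aSeries (u ++ [Letter.b]) (bTrunc r P * (polyA + polyB - 1) * krasnerPoly J M + 1))
      (L := aSeries (u ++ [Letter.b]) (P - bTrunc r P))
      (Z := aSeries (u ++ [Letter.b]) (P * (polyA + polyB - 1) * krasnerPoly J M + 1))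
      ?_ ?_ ?_ ?_ m
    · simpa [coeff_aSeries, -coef_add] using this
    · intro i hi
      rw [coeff_aSeries, coef_add, coef_one, if_neg (by simp), add_zero]
      by_contra h
      rw [mul_assoc] at h
      obtain ⟨x, y, he, hx, hy⟩ := coef_mul_ne_zero h
      have hxr := degBLE_bTrunc r P x hx
      rw [List.append_assoc, List.singleton_append] at he
      -- The prefix x has at most r letters b, so it ends before the b following u. That b therefore
      -- lies in y, a word of (A - 1)S.
      rcases List.append_eq_append_iff.1 he with ⟨t, rfl, ht⟩ | ⟨t, rfl, ht⟩
      · cases t with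
        | nil =>
          rw [List.nil_append] at ht
          rw [← ht] at hy
          exact hy (coef_alphabet_mul_krasnerPoly hi [])
        | cons c t =>
          rw [List.cons_append, List.cons.injEq] at ht
          rw [List.count_append, hu, ← ht.1, List.count_cons_self] at hxr
          omega
      · rw [ht] at hy
        exact hy (coef_alphabet_mul_krasnerPoly hi t)
    · intro i
      rw [coeff_aSeries, coef_sub, coef_bTrunc]
      split_ifs
      · simp
      · simpa using hP _
    · intro i
      rw [coeff_aSeries]
      exact hX _
    · rw [hsplit, aSeries_add, hmul]
  · have hXa : bTrunc r P * (polyA + polyB - 1) * krasnerPoly J M + 1 =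
        bTrunc r P * (polyA - 1) * krasnerPoly J M + bTrunc r P * polyB * krasnerPoly J M + 1 := by
      noncomm_ring
    -- Only a - 1 brings negative signs, and its product has at most r + 0 + 1 letters b.
    have h1 : coef (bTrunc r P * (polyA - 1) * krasnerPoly J M) w = 0 := by
      by_contra h
      have := ((degBLE_bTrunc r P).mul degBLE_polyA_sub_one).mul (degBLE_krasnerPoly J M) w h
      omega
    rw [hXa, coef_add, coef_add, h1, zero_add]
    exact add_nonneg (coef_mul_nonneg (coef_mul_nonneg hPr (coef_word_nonneg _))
      (coef_krasnerPoly_nonneg J M) w) (coef_one_nonneg w)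

end KrasnerCodes

/-! ### The truncated pair and the b-degree of its code -/

theorem mainTheorem6 (n : ℕ) (I J : Finset ℕ) (hIJ : KrasnerCodes.IsKrasner n I J)
    (M : ℕ → Finset ℕ) (k : ℕ) (P S : KrasnerCodes.Poly)
    (hP0 : ∀ w, 0 ≤ KrasnerCodes.coef P w)
    (hP : P = ∑ g ∈ Finset.range (k + 2), KrasnerCodes.bPart g P)
    (hS : S = KrasnerCodes.aPow J +
      ∑ j ∈ J, KrasnerCodes.aPow (M j) * KrasnerCodes.polyB * KrasnerCodes.polyA ^ j)
    (C : Finset (List KrasnerCodes.Letter)) (hC : KrasnerCodes.IsMCode (k + 3) C)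
    (hPS : KrasnerCodes.IsPositiveFactorization P S C) :
    ∀ r ≤ k, KrasnerCodes.bPart r P ≠ 0 →
      ∃ C' : Finset (List KrasnerCodes.Letter), KrasnerCodes.IsMCode (r + 2) C' ∧
        KrasnerCodes.IsPositiveFactorization
          (∑ g ∈ Finset.range (r + 1), KrasnerCodes.bPart g P) S C' := by
  open KrasnerCodes in
  intro r _ hr
  obtain ⟨⟨-, hCX⟩, hpos⟩ := hPS
  change S = krasnerPoly J M at hS
  subst hS
  change P = bTrunc (k + 1) P at hP
  change ∃ C', IsMCode (r + 2) C' ∧ IsPositiveFactorization (bTrunc r P) (krasnerPoly J M) C'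
  have hS0 := coef_krasnerPoly_nonneg J M
  have hPr : ∀ w, 0 ≤ coef (bTrunc r P) w := fun w => by
    rw [coef_bTrunc]; split_ifs; exacts [hP0 w, le_rfl]
  have hzo : HasCoeffsZeroOne P ∧ HasCoeffsZeroOne (krasnerPoly J M) := by
    -- If -P had coefficients 0 or 1, nonnegativity of P would force P = 0, against P_r ≠ 0.
    refine hpos.resolve_right fun ⟨h, _⟩ => hr (poly_ext fun w => ?_)
    have h1 := h w
    have h2 := hP0 w
    rw [coef_neg] at h1
    have h3 : coef P w = 0 := by omega
    rw [coef_bPart, h3, ite_self, coef_zero]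
  have hnil : [] ∉ C := by simpa using hC.1.prop.epsilon_not_mem
  have hXn := coef_bTrunc_factorization_nonneg hIJ M hP0 (fun w => by
    rw [← hCX, coef_charPoly]; split_ifs <;> simp) r
  have hX0 : coef (bTrunc r P * (polyA + polyB - 1) * krasnerPoly J M + 1) [] = 0 := by
    have h : coef (charPoly C) [] = 0 := by rw [coef_charPoly, if_neg hnil]
    have hsplit : P * (polyA + polyB - 1) * krasnerPoly J M + 1 =
        (bTrunc r P * (polyA + polyB - 1) * krasnerPoly J M + 1) +
          (P - bTrunc r P) * ((polyA + polyB - 1) * krasnerPoly J M) := by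
      noncomm_ring
    rwa [hCX, hsplit, coef_add, coef_sub_bTrunc_mul P _ (by simp), add_zero] at h
  obtain ⟨C', hC', hCX'⟩ := exists_isMaximalCode rfl hPr hS0 hXn hX0
  refine ⟨C', ⟨hC', fun w hw => ?_, ?_⟩, ⟨hC', hCX'⟩, Or.inl ⟨fun w => ?_, hzo.2⟩⟩
  · by_contra hc
    have h1 : coef (charPoly C') w = 1 := by rw [coef_charPoly, if_pos hw]
    rw [hCX', coef_add, coef_one, if_neg (by rintro rfl; simp at hc), add_zero] at h1
    have := ((degBLE_bTrunc r P).mul degBLE_alphabet_sub_one).mul (degBLE_krasnerPoly J M) w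
      (by rw [h1]; exact one_ne_zero)
    omega
  -- If S had no word containing b, the words of C would have at most (k + 1) + 1 + 0 letters b,
  -- against the word with k + 3.
  · obtain ⟨s, hs, hsb⟩ : ∃ s, coef (krasnerPoly J M) s ≠ 0 ∧ s.count Letter.b = 1 := by
      by_contra! hc
      have hdeg : DegBLE 0 (krasnerPoly J M) := fun w hw => by
        have h1 := hc w hw
        have h2 := degBLE_krasnerPoly J M w hw
        omega
      obtain ⟨w, hw, hwb⟩ := hC.2.2
      have h1 : coef (charPoly C) w = 1 := by rw [coef_charPoly, if_pos hw]
      rw [hCX, coef_add, coef_one, if_neg (by rintro rfl; simp at hwb), add_zero, hP] at h1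
      have := ((degBLE_bTrunc (k + 1) P).mul degBLE_alphabet_sub_one).mul hdeg w
        (by rw [h1]; exact one_ne_zero)
      omega
    obtain ⟨p, hp⟩ : ∃ p, coef (bPart r P) p ≠ 0 := by
      by_contra! hc
      exact hr (poly_ext hc)
    rw [coef_bPart] at hp
    obtain ⟨hpb, hp⟩ : p.count Letter.b = r ∧ coef P p ≠ 0 := by
      by_cases h : p.count Letter.b = r
      · exact ⟨h, by rwa [if_pos h] at hp⟩
      · exact absurd (if_neg h) hp
    have hcount : (p ++ [Letter.b] ++ s).count Letter.b = r + 2 := by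
      simp [hpb, hsb]
    -- The witness takes p from P_r and s from the part of S containing b. Its coefficient is
    -- positive because the term with a - 1 cannot reach r + 2 letters b and nothing else is
    -- negative.
    refine ⟨p ++ [Letter.b] ++ s, ?_, hcount⟩
    have hXa : bTrunc r P * (polyA + polyB - 1) * krasnerPoly J M + 1 =
        bTrunc r P * (polyA - 1) * krasnerPoly J M + bTrunc r P * polyB * krasnerPoly J M + 1 := by
      noncomm_ring
    have h1 : coef (bTrunc r P * (polyA - 1) * krasnerPoly J M) (p ++ [Letter.b] ++ s) = 0 := by
      by_contra h
      have := ((degBLE_bTrunc r P).mul degBLE_polyA_sub_one).mul (degBLE_krasnerPoly J M) _ h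
      omega
    have hB0 : ∀ w, 0 ≤ coef polyB w := coef_word_nonneg _
    have h2 := le_coef_mul hPr hB0 p [Letter.b]
    have h3 := le_coef_mul (coef_mul_nonneg hPr hB0) hS0 (p ++ [Letter.b]) s
    have h4 : 0 < coef (bTrunc r P) p := by
      rw [coef_bTrunc, if_pos hpb.le]
      exact lt_of_le_of_ne (hP0 p) hp.symm
    have h5 : coef polyB [Letter.b] = 1 := by rw [polyB, coef_word, if_pos rfl]
    have h6 : 0 < coef (krasnerPoly J M) s := lt_of_le_of_ne (hS0 s) hs.symm
    rw [h5, mul_one] at h2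
    have h7 := mul_pos (h4.trans_le h2) h6
    by_contra hc
    have h8 : coef (charPoly C') (p ++ [Letter.b] ++ s) = 0 := by rw [coef_charPoly, if_neg hc]
    rw [hCX', hXa, coef_add, coef_add, h1, zero_add] at h8
    have h9 := coef_one_nonneg (p ++ [Letter.b] ++ s)
    linarith
  · rw [coef_bTrunc]
    split_ifs
    · exact hzo.1 w
    · exact Or.inl rfl
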